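/- Let $X$ be a nonempty smooth spacetime, i.e. a (Hausdorff, finite-dimensional) smooth manifold with a smooth Lorentzian metric of signature $(-,+,\dots,+)$ and a time orientation given by a continuous timelike vector field. For $U\subseteq X$ write $p\ll_U q$ if there is a piecewise smooth future-directed timelike curve in $U$ from $p$ to $q$, and $p\le_U q$ if $p=q$ or there is a piecewise smooth future-directed causal curve in $U$ from $p$ to $q$. A continuous path $c\colon[0,1]\to X$ is called (future-directed) timelike, respectively causal, if for every $t_0\in[0,1]$ and every neighbourhood $U$ of $c(t_0)$ there is a neighbourhood $J$ of $t_0$ in $[0,1]$ such that $c(t_1)\ll_U c(t_2)$, respectively $c(t_1)\le_U c(t_2)$, for all $t_1<t_2$ in $J$; in particular constant paths are causal. Two timelike (causal) paths from $x$ to $y$ are homotopic if there is a homotopy between them, relative to the endpoints, all of whose intermediate paths are timelike (causal). Let $\Pi^{\mathrm t}(X)$ and $\Pi^{\mathrm c}(X)$ have the points of $X$ as objects, the homotopy classes of timelike, respectively causal, paths from $x$ to $y$ as morphisms $x\to y$, and concatenation of paths as composition. Thus $\Pi^{\mathrm t}(X)$ is a semicategory (its composition is associative, but identities are not required), and $\Pi^{\mathrm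 c}(X)$ is a category whose identity morphisms are the classes of the constant paths. Then: 1. A causal path from $x$ to $x$ represents the identity morphism of $x$ in $\Pi^{\mathrm c}(X)$ if and only if it is the constant path at $x$. 2. Every morphism of $\Pi^{\mathrm c}(X)$ that has an inverse is an identity morphism; and $\Pi^{\mathrm c}(X)$ is not a groupoid. 3. No morphism $e\colon x\to x$ of $\Pi^{\mathrm t}(X)$ is an identity morphism, i.e. satisfies both $f\circ e=f$ for all $f\colon x\to y$ and $e\circ f=f$ for all $f\colon y\to x$ (for all $y$); and $\Pi^{\mathrm t}(X)$ is not a category, i.e. it is not the case that every object has an identity morphism. -/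

import Mathlib

open Set Topology unitInterval CategoryTheory
open scoped Manifold ContDiff Bundle

/-! ## Spacetimes -/

/-- A smooth Lorentzian metric of signature `(-, +, …, +)` on a smooth manifold `X` modelled on
the finite-dimensional real vector space `E`. -/
structure LorentzianMetric (E : Type*) [NormedAddCommGroup E] [NormedSpace ℝ E]
    (X : Type*) [TopologicalSpace X] [ChartedSpace E X] [IsManifold 𝓘(ℝ, E) ∞ X] where
  /-- the bilinear form on each tangent space -/
  val (x : X) : TangentSpace 𝓘(ℝ, E) x →L[ℝ] TangentSpace 𝓘(ℝ, E) x →L[ℝ] ℝ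
  symm (x : X) (v w : TangentSpace 𝓘(ℝ, E) x) : val x v w = val x w v
  /-- every tangent space splits as a negative definite line plus a positive definite
  orthogonal complement -/
  signature (x : X) : ∃ v : TangentSpace 𝓘(ℝ, E) x, val x v v < 0 ∧
    ∀ w : TangentSpace 𝓘(ℝ, E) x, val x v w = 0 → w ≠ 0 → 0 < val x w w
  smooth : ContMDiff 𝓘(ℝ, E) (𝓘(ℝ, E).prod 𝓘(ℝ, E →L[ℝ] E →L[ℝ] ℝ)) ∞
    (fun x ↦ Bundle.TotalSpace.mk' (E →L[ℝ] E →L[ℝ] ℝ)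
      (E := fun x : X ↦ TangentSpace 𝓘(ℝ, E) x →L[ℝ] TangentSpace 𝓘(ℝ, E) x →L[ℝ] ℝ) x (val x))

/-- The structure of a spacetime on a smooth manifold: a smooth Lorentzian metric together with a
time orientation, given by a continuous timelike vector field (which is declared to point to the
future). -/
structure Spacetime (E : Type*) [NormedAddCommGroup E] [NormedSpace ℝ E]
    (X : Type*) [TopologicalSpace X] [ChartedSpace E X] [IsManifold 𝓘(ℝ, E) ∞ X] where
  metric : LorentzianMetric E X
  timeField (x : X) : TangentSpace 𝓘(ℝ, E) x
  timelike_timeField (x : X) : metric.val x (timeField x) (timeField x) < 0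
  continuous_timeField : Continuous fun x ↦ (⟨x, timeField x⟩ : TangentBundle 𝓘(ℝ, E) X)

/-! ## Paths that are locally related, their homotopies, and their concatenation

Timelike and causal paths are treated simultaneously: `R U p q` is to be read as
"`p` precedes `q` inside `U`". -/

section LocallyRelated

variable {X : Type*} [TopologicalSpace X]

/-- Near each parameter, and inside each prescribed neighbourhood, earlier points of `c` precede
later points of `c`. -/
def LocallyRelated (R : Set X → X → X → Prop) (c : I → X) : Prop :=
  ∀ t₀ : I, ∀ U ∈ 𝓝 (c t₀), ∃ J ∈ 𝓝 t₀, ∀ t₁ ∈ J, ∀ t₂ ∈ J, t₁ < t₂ → R U (c t₁) (c t₂)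

/-- The space of locally `R`-related paths from `x` to `y`. -/
abbrev RelPath (R : Set X → X → X → Prop) (x y : X) : Type _ :=
  {c : Path x y // LocallyRelated R c}

/-- Homotopy relative to the endpoints through locally `R`-related paths. -/
def RelHomotopic (R : Set X → X → X → Prop) {x y : X} (c₀ c₁ : RelPath R x y) : Prop :=
  ∃ H : Path.Homotopy c₀.1 c₁.1, ∀ s : I, LocallyRelated R (H.eval s)

variable {R : Set X → X → X → Prop}

theorem LocallyRelated.comp {c : I → X} (hc : LocallyRelated R c) {f : I → I}
    (hf : Continuous f) (hm : StrictMono f) : LocallyRelated R (c ∘ f) := by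
  intro t₀ U hU
  obtain ⟨J, hJ, h⟩ := hc (f t₀) U hU
  exact ⟨f ⁻¹' J, hf.continuousAt hJ, fun t₁ h₁ t₂ h₂ h₁₂ ↦ h _ h₁ _ h₂ (hm h₁₂)⟩

theorem LocallyRelated.comp_monotone (hR : ∀ U, ∀ x ∈ U, R U x x) {c : I → X}
    (hcc : Continuous c) (hc : LocallyRelated R c) {f : I → I}
    (hf : Continuous f) (hm : Monotone f) : LocallyRelated R (c ∘ f) := by
  intro t₀ U hU
  obtain ⟨J, hJ, h⟩ := hc (f t₀) U hU
  refine ⟨f ⁻¹' J ∩ (c ∘ f) ⁻¹' U, Filter.inter_mem (hf.continuousAt hJ)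
    ((hcc.comp hf).continuousAt hU), fun t₁ h₁ t₂ h₂ h₁₂ ↦ ?_⟩
  rcases (hm h₁₂.le).eq_or_lt with he | hlt
  · have h3 : (c ∘ f) t₁ ∈ U := h₁.2
    simp only [Function.comp_apply] at h3 ⊢
    rw [← he]
    exact hR _ _ h3
  · exact h _ h₁.1 _ h₂.1 hlt

theorem LocallyRelated.trans (hR : ∀ U x y z, R U x y → R U y z → R U x z) {x y z : X}
    {a : Path x y} {b : Path y z} (ha : LocallyRelated R a) (hb : LocallyRelated R b) :
    LocallyRelated R (a.trans b) := by
  have hφ : Continuous fun t : I ↦ projIcc (0 : ℝ) 1 zero_le_one (2 * t) := by fun_prop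
  have hψ : Continuous fun t : I ↦ projIcc (0 : ℝ) 1 zero_le_one (2 * t - 1) := by fun_prop
  set φ : I → I := fun t : I ↦ projIcc (0 : ℝ) 1 zero_le_one (2 * t) with hφd
  set ψ : I → I := fun t : I ↦ projIcc (0 : ℝ) 1 zero_le_one (2 * t - 1) with hψd
  have eφ : ∀ t : I, (t : ℝ) ≤ 1 / 2 → a.trans b t = a (φ t) := by
    intro t ht
    rw [Path.trans_apply, dif_pos ht]
    congr 1
    exact (projIcc_of_mem zero_le_one _).symm
  have eψ : ∀ t : I, 1 / 2 ≤ (t : ℝ) → a.trans b t = b (ψ t) := by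
    intro t ht
    rcases ht.eq_or_lt with he | hlt
    · rw [Path.trans_apply, dif_pos he.ge]
      have h1 : ψ t = 0 := by
        simp only [hψd, ← he]
        norm_num
      rw [h1, b.source]
      convert a.target
      simp [← he]
    · rw [Path.trans_apply, dif_neg hlt.not_ge]
      congr 1
      exact (projIcc_of_mem zero_le_one _).symm
  have mφ : ∀ s t : I, s < t → (t : ℝ) ≤ 1 / 2 → φ s < φ t := by
    intro s t hst ht
    have hst' : (s : ℝ) < t := hst
    have hs := s.2.1
    exact strictMonoOn_projIcc zero_le_one ⟨by linarith, by linarith⟩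
      ⟨by linarith, by linarith⟩ (by linarith)
  have mψ : ∀ s t : I, s < t → 1 / 2 ≤ (s : ℝ) → ψ s < ψ t := by
    intro s t hst hs
    have hst' : (s : ℝ) < t := hst
    have ht := t.2.2
    exact strictMonoOn_projIcc zero_le_one ⟨by linarith, by linarith⟩
      ⟨by linarith, by linarith⟩ (by linarith)
  intro t₀ U hU
  rcases lt_trichotomy (t₀ : ℝ) (1 / 2) with h | h | h
  · rw [eφ t₀ h.le] at hU
    obtain ⟨J, hJ, hJR⟩ := ha _ U hU
    refine ⟨φ ⁻¹' J ∩ {t : I | (t : ℝ) < 1 / 2}, Filter.inter_mem (hφ.continuousAt hJ)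
      ((isOpen_lt continuous_subtype_val continuous_const).mem_nhds h), ?_⟩
    rintro t₁ ⟨h₁, h₁'⟩ t₂ ⟨h₂, h₂'⟩ h₁₂
    rw [eφ _ h₁'.le, eφ _ h₂'.le]
    exact hJR _ h₁ _ h₂ (mφ _ _ h₁₂ h₂'.le)
  · have hφ1 : φ t₀ = 1 := by
      simp only [hφd, h]
      norm_num
    have hψ0 : ψ t₀ = 0 := by
      simp only [hψd, h]
      norm_num
    have hUa := hU
    rw [eφ t₀ h.le] at hUa
    rw [eψ t₀ h.ge] at hU
    obtain ⟨J, hJ, hJR⟩ := ha _ U hUa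
    obtain ⟨K, hK, hKR⟩ := hb _ U hU
    refine ⟨φ ⁻¹' J ∩ ψ ⁻¹' K, Filter.inter_mem (hφ.continuousAt hJ) (hψ.continuousAt hK), ?_⟩
    rintro t₁ ⟨h₁, h₁'⟩ t₂ ⟨h₂, h₂'⟩ h₁₂
    rcases le_or_gt (t₂ : ℝ) (1 / 2) with k₂ | k₂
    · have k₁ : (t₁ : ℝ) ≤ 1 / 2 := le_trans (le_of_lt h₁₂) k₂
      rw [eφ _ k₁, eφ _ k₂]
      exact hJR _ h₁ _ h₂ (mφ _ _ h₁₂ k₂)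
    · rcases le_or_gt (1 / 2) (t₁ : ℝ) with k₁ | k₁
      · rw [eψ _ k₁, eψ _ k₂.le]
        exact hKR _ h₁' _ h₂' (mψ _ _ h₁₂ k₁)
      · rw [eφ _ k₁.le, eψ _ k₂.le]
        have l₁ : t₁ < t₀ := by
          rw [← h] at k₁
          exact k₁
        have l₂ : t₀ < t₂ := by
          rw [← h] at k₂
          exact k₂
        have r₁ := hJR _ h₁ _ (mem_of_mem_nhds hJ) (mφ _ _ l₁ h.le)
        have r₂ := hKR _ (mem_of_mem_nhds hK) _ h₂' (mψ _ _ l₂ h.ge)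
        rw [hφ1, a.target] at r₁
        rw [hψ0, b.source] at r₂
        exact hR _ _ _ _ r₁ r₂
  · rw [eψ t₀ h.le] at hU
    obtain ⟨J, hJ, hJR⟩ := hb _ U hU
    refine ⟨ψ ⁻¹' J ∩ {t : I | 1 / 2 < (t : ℝ)}, Filter.inter_mem (hψ.continuousAt hJ)
      ((isOpen_lt continuous_const continuous_subtype_val).mem_nhds h), ?_⟩
    rintro t₁ ⟨h₁, h₁'⟩ t₂ ⟨h₂, h₂'⟩ h₁₂
    rw [eψ _ h₁'.le, eψ _ h₂'.le]
    exact hJR _ h₁ _ h₂ (mψ _ _ h₁₂ h₁'.le)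

theorem RelHomotopic.refl {x y : X} (c : RelPath R x y) : RelHomotopic R c c :=
  ⟨Path.Homotopy.refl c.1, fun _ ↦ c.2⟩

theorem RelHomotopic.symm {x y : X} {c d : RelPath R x y} (h : RelHomotopic R c d) :
    RelHomotopic R d c := by
  obtain ⟨H, hH⟩ := h
  exact ⟨H.symm, fun s ↦ hH (σ s)⟩

theorem RelHomotopic.trans {x y : X} {c d e : RelPath R x y} (h : RelHomotopic R c d)
    (k : RelHomotopic R d e) : RelHomotopic R c e := by
  obtain ⟨H, hH⟩ := h
  obtain ⟨K, hK⟩ := k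
  refine ⟨H.trans K, fun s ↦ ?_⟩
  by_cases hs : (s : ℝ) ≤ 1 / 2
  · convert hH ⟨2 * s, (unitInterval.mul_pos_mem_iff zero_lt_two).2 ⟨s.2.1, hs⟩⟩ using 2
    ext t
    change (H.trans K) (s, t) = H _
    rw [Path.Homotopy.trans_apply, dif_pos hs]
  · convert hK ⟨2 * s - 1,
      unitInterval.two_mul_sub_one_mem_iff.2 ⟨(not_le.1 hs).le, s.2.2⟩⟩ using 2
    ext t
    change (H.trans K) (s, t) = K _
    rw [Path.Homotopy.trans_apply, dif_neg hs]

instance RelPath.setoid (R : Set X → X → X → Prop) (x y : X) : Setoid (RelPath R x y) where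
  r := RelHomotopic R
  iseqv := ⟨RelHomotopic.refl, RelHomotopic.symm, RelHomotopic.trans⟩

/-- Homotopy classes of locally `R`-related paths from `x` to `y`. -/
def RelClass (R : Set X → X → X → Prop) (x y : X) : Type _ := Quotient (RelPath.setoid R x y)

/-- The homotopy class of a path. -/
def RelPath.cls {x y : X} (c : RelPath R x y) : RelClass R x y := Quotient.mk _ c

/-- Concatenation: first `a`, then `b`, each at double speed. -/
noncomputable def RelPath.trans (hR : ∀ U x y z, R U x y → R U y z → R U x z) {x y z : X}
    (a : RelPath R x y) (b : RelPath R y z) : RelPath R x z :=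
  ⟨a.1.trans b.1, a.2.trans hR b.2⟩

theorem RelHomotopic.hcomp (hR : ∀ U x y z, R U x y → R U y z → R U x z) {x y z : X}
    {a a' : RelPath R x y} {b b' : RelPath R y z} (h : RelHomotopic R a a')
    (k : RelHomotopic R b b') : RelHomotopic R (a.trans hR b) (a'.trans hR b') := by
  obtain ⟨H, hH⟩ := h
  obtain ⟨K, hK⟩ := k
  refine ⟨H.hcomp K, fun s ↦ ?_⟩
  have he : (H.hcomp K).eval s = (H.eval s).trans (K.eval s) := by
    ext t
    change (H.hcomp K) (s, t) = _
    rw [Path.Homotopy.hcomp_apply, Path.trans_apply]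
  have h := (hH s).trans hR (hK s)
  rw [← he] at h
  exact h

/-- The composition `[b][a] = [ba]` of homotopy classes. -/
noncomputable def RelClass.comp (hR : ∀ U x y z, R U x y → R U y z → R U x z) {x y z : X}
    (a : RelClass R x y) (b : RelClass R y z) : RelClass R x z :=
  Quotient.map₂ (RelPath.trans hR) (fun _ _ h _ _ k ↦ RelHomotopic.hcomp hR h k) a b

theorem RelHomotopic.of_reparam {x y : X} (c d : RelPath R x y) (f : I → I) (hf : Continuous f)
    (h₀ : f 0 = 0) (h₁ : f 1 = 1) (hd : d.1 = c.1.reparam f hf h₀ h₁)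
    (h : ∀ φ : I → I, Continuous φ → (StrictMono f → StrictMono φ) → (Monotone f → Monotone φ) →
      LocallyRelated R (c.1 ∘ φ)) : RelHomotopic R c d := by
  refine ⟨(Path.Homotopy.reparam c.1 f hf h₀ h₁).cast rfl hd.symm, fun s ↦ ?_⟩
  have hmem : ∀ t : I, (1 - (s : ℝ)) * t + s * f t ∈ I := fun t ↦
    convex_Icc (0 : ℝ) 1 t.2 (f t).2 (by linarith [s.2.2]) s.2.1 (by ring)
  rcases s.2.1.eq_or_lt with hs | hs
  · refine h (fun t ↦ ⟨(1 - (s : ℝ)) * t + s * f t, hmem t⟩) (by fun_prop) ?_ ?_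
    · intro _ t u htu
      have htu' : (t : ℝ) < u := htu
      change (1 - (s : ℝ)) * t + s * f t < (1 - (s : ℝ)) * u + s * f u
      rw [← hs]
      linarith
    · intro _ t u htu
      have htu' : (t : ℝ) ≤ u := htu
      change (1 - (s : ℝ)) * t + s * f t ≤ (1 - (s : ℝ)) * u + s * f u
      rw [← hs]
      linarith
  · refine h (fun t ↦ ⟨(1 - (s : ℝ)) * t + s * f t, hmem t⟩) (by fun_prop) ?_ ?_
    · intro hm t u htu
      have htu' : (t : ℝ) < u := htu
      have hfu : (f t : ℝ) < f u := hm htu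
      change (1 - (s : ℝ)) * t + s * f t < (1 - (s : ℝ)) * u + s * f u
      have h1 : (1 - (s : ℝ)) * t ≤ (1 - (s : ℝ)) * u :=
        mul_le_mul_of_nonneg_left htu'.le (by linarith [s.2.2])
      have h2 : (s : ℝ) * f t < s * f u := mul_lt_mul_of_pos_left hfu hs
      linarith
    · intro hm t u htu
      have htu' : (t : ℝ) ≤ u := htu
      have hfu : (f t : ℝ) ≤ f u := hm htu
      change (1 - (s : ℝ)) * t + s * f t ≤ (1 - (s : ℝ)) * u + s * f u
      have h1 : (1 - (s : ℝ)) * t ≤ (1 - (s : ℝ)) * u :=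
        mul_le_mul_of_nonneg_left htu' (by linarith [s.2.2])
      have h2 : (s : ℝ) * f t ≤ s * f u := mul_le_mul_of_nonneg_left hfu hs.le
      linarith

theorem RelHomotopic.assoc (hR : ∀ U x y z, R U x y → R U y z → R U x z) {w x y z : X}
    (a : RelPath R w x) (b : RelPath R x y) (c : RelPath R y z) :
    RelHomotopic R ((a.trans hR b).trans hR c) (a.trans hR (b.trans hR c)) := by
  refine (RelHomotopic.of_reparam (a.trans hR (b.trans hR c)) ((a.trans hR b).trans hR c) _ _ _ _
    (Path.Homotopy.trans_assoc_reparam a.1 b.1 c.1) fun φ hφ hm _ ↦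
      (a.trans hR (b.trans hR c)).2.comp hφ (hm ?_)).symm
  intro s t hst
  have hst' : (s : ℝ) < t := hst
  change Path.Homotopy.transAssocReparamAux s < Path.Homotopy.transAssocReparamAux t
  unfold Path.Homotopy.transAssocReparamAux
  split_ifs <;> linarith

theorem RelClass.comp_assoc (hR : ∀ U x y z, R U x y → R U y z → R U x z) {w x y z : X}
    (a : RelClass R w x) (b : RelClass R x y) (c : RelClass R y z) :
    (a.comp hR b).comp hR c = a.comp hR (b.comp hR c) := by
  induction a using Quotient.inductionOn
  induction b using Quotient.inductionOn
  induction c using Quotient.inductionOn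
  exact Quotient.sound (RelHomotopic.assoc hR _ _ _)

/-- The constant path. -/
def RelPath.const (h₁ : ∀ U, ∀ x ∈ U, R U x x) (x : X) : RelPath R x x :=
  ⟨Path.refl x, fun _ U hU ↦ ⟨univ, Filter.univ_mem, fun _ _ _ _ _ ↦ h₁ U x (mem_of_mem_nhds hU)⟩⟩

theorem RelClass.comp_const (hR : ∀ U x y z, R U x y → R U y z → R U x z)
    (h₁ : ∀ U, ∀ x ∈ U, R U x x) {x y : X} (a : RelClass R x y) :
    a.comp hR (RelPath.const h₁ y).cls = a := by
  induction a using Quotient.inductionOn with | h a => ?_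
  refine Quotient.sound (RelHomotopic.of_reparam a (a.trans hR (RelPath.const h₁ y)) _ _ _ _
    (Path.Homotopy.trans_refl_reparam a.1) fun φ hφ _ hm ↦
      a.2.comp_monotone h₁ a.1.continuous hφ (hm ?_)).symm
  intro s t hst
  have hst' : (s : ℝ) ≤ t := hst
  change Path.Homotopy.transReflReparamAux s ≤ Path.Homotopy.transReflReparamAux t
  unfold Path.Homotopy.transReflReparamAux
  split_ifs <;> linarith

theorem RelClass.const_comp (hR : ∀ U x y z, R U x y → R U y z → R U x z)
    (h₁ : ∀ U, ∀ x ∈ U, R U x x) {x y : X} (a : RelClass R x y) :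
    RelClass.comp hR (RelPath.const h₁ x).cls a = a := by
  induction a using Quotient.inductionOn with | h a => ?_
  refine Quotient.sound (RelHomotopic.of_reparam a ((RelPath.const h₁ x).trans hR a)
    (fun t : I ↦ projIcc (0 : ℝ) 1 zero_le_one (2 * t - 1)) (by fun_prop) (by norm_num)
    (by norm_num) ?_ fun φ hφ _ hm ↦ a.2.comp_monotone h₁ a.1.continuous hφ (hm ?_)).symm
  · ext t
    change (Path.refl x).trans a.1 t = _
    rw [Path.trans_apply, Path.coe_reparam, Function.comp_apply]
    split_ifs with h
    · rw [projIcc_of_le_left zero_le_one (by linarith)]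
      exact a.1.source.symm
    · congr 1
      exact (projIcc_of_mem zero_le_one _).symm
  · intro s t hst
    have hst' : (s : ℝ) ≤ t := hst
    exact monotone_projIcc zero_le_one (by linarith)

end LocallyRelated

/-! ## Causality on a spacetime -/

namespace Spacetime

section

variable {E : Type*} [NormedAddCommGroup E] [NormedSpace ℝ E]
  {X : Type*} [TopologicalSpace X] [ChartedSpace E X] [IsManifold 𝓘(ℝ, E) ∞ X]

/-- Future-directed timelike tangent vectors. -/
def IsFutureTimelike (S : Spacetime E X) {x : X} (v : TangentSpace 𝓘(ℝ, E) x) : Prop :=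
  S.metric.val x v v < 0 ∧ S.metric.val x (S.timeField x) v < 0

/-- Future-directed causal tangent vectors; the second condition excludes the zero vector. -/
def IsFutureCausal (S : Spacetime E X) {x : X} (v : TangentSpace 𝓘(ℝ, E) x) : Prop :=
  S.metric.val x v v ≤ 0 ∧ S.metric.val x (S.timeField x) v < 0

/-- There is a smooth future-directed timelike curve in `U` from `p` to `q`. -/
def TimelikeCurve (S : Spacetime E X) (U : Set X) (p q : X) : Prop :=
  ∃ γ : ℝ → X, ContMDiffOn 𝓘(ℝ, ℝ) 𝓘(ℝ, E) ∞ γ (Icc 0 1) ∧ MapsTo γ (Icc 0 1) U ∧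
    γ 0 = p ∧ γ 1 = q ∧ ∀ t ∈ Icc (0 : ℝ) 1,
      S.IsFutureTimelike (mfderivWithin 𝓘(ℝ, ℝ) 𝓘(ℝ, E) γ (Icc 0 1) t (1 : ℝ))

/-- There is a smooth future-directed causal curve in `U` from `p` to `q`. -/
def CausalCurve (S : Spacetime E X) (U : Set X) (p q : X) : Prop :=
  ∃ γ : ℝ → X, ContMDiffOn 𝓘(ℝ, ℝ) 𝓘(ℝ, E) ∞ γ (Icc 0 1) ∧ MapsTo γ (Icc 0 1) U ∧
    γ 0 = p ∧ γ 1 = q ∧ ∀ t ∈ Icc (0 : ℝ) 1,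
      S.IsFutureCausal (mfderivWithin 𝓘(ℝ, ℝ) 𝓘(ℝ, E) γ (Icc 0 1) t (1 : ℝ))

/-- The chronological relation `p ≪ q` of `U`: there is a piecewise smooth future-directed timelike
curve in `U` from `p` to `q`. -/
def Chron (S : Spacetime E X) (U : Set X) : X → X → Prop :=
  Relation.TransGen (S.TimelikeCurve U)

/-- The causal relation `p ≤ q` of `U`: `p = q`, or there is a piecewise smooth
future-directed causal curve in `U` from `p` to `q`. -/
def Caus (S : Spacetime E X) (U : Set X) : X → X → Prop :=
  Relation.ReflTransGen (S.CausalCurve U)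

theorem chron_trans (S : Spacetime E X) (U : Set X) (x y z : X) (h : S.Chron U x y)
    (k : S.Chron U y z) : S.Chron U x z := Relation.TransGen.trans h k

theorem caus_trans (S : Spacetime E X) (U : Set X) (x y z : X) (h : S.Caus U x y)
    (k : S.Caus U y z) : S.Caus U x z := Relation.ReflTransGen.trans h k

theorem caus_refl (S : Spacetime E X) (U : Set X) (x : X) (_ : x ∈ U) : S.Caus U x x :=
  Relation.ReflTransGen.refl

/-- Continuous future-directed timelike paths from `x` to `y`: locally, earlier points
chronologically precede later points. -/
abbrev TimelikePath (S : Spacetime E X) (x y : X) : Type _ := RelPath S.Chron x y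

/-- Continuous future-directed causal paths from `x` to `y`: locally, earlier points
causally precede later points. Constant paths are causal. -/
abbrev CausalPath (S : Spacetime E X) (x y : X) : Type _ := RelPath S.Caus x y

/-- The objects of the category of causal homotopy classes: the points of `X`. -/
@[ext]
structure PiC (S : Spacetime E X) where
  pt : X

/-- The objects of the semicategory of timelike homotopy classes: the points of `X`. -/
@[ext]
structure PiT (S : Spacetime E X) where
  pt : X

end

end Spacetime

/-! ## Semicategories -/

/-- A semicategory: objects, morphisms and an associative composition (in diagrammatic order),
with no identity morphisms required. -/
class Semicategory (C : Type*) extends Quiver C where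
  comp {x y z : C} (f : x ⟶ y) (g : y ⟶ z) : x ⟶ z
  assoc {w x y z : C} (f : w ⟶ x) (g : x ⟶ y) (h : y ⟶ z) :
    comp (comp f g) h = comp f (comp g h)

/-- `e : x ⟶ x` is an identity morphism: it is neutral for composition on both sides. -/
def Semicategory.IsIdentity {C : Type*} [Semicategory C] {x : C} (e : x ⟶ x) : Prop :=
  (∀ (y : C) (f : x ⟶ y), Semicategory.comp e f = f) ∧
    ∀ (y : C) (f : y ⟶ x), Semicategory.comp f e = f

/-- A semicategory is a category if every object has an identity morphism. -/
def Semicategory.IsCategory (C : Type*) [Semicategory C] : Prop :=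
  ∀ x : C, ∃ e : x ⟶ x, Semicategory.IsIdentity e

namespace Spacetime

section

variable {E : Type*} [NormedAddCommGroup E] [NormedSpace ℝ E]
  {X : Type*} [TopologicalSpace X] [ChartedSpace E X] [IsManifold 𝓘(ℝ, E) ∞ X]

/-- The semicategory of timelike homotopy classes. -/
noncomputable instance (S : Spacetime E X) : Semicategory S.PiT where
  Hom x y := RelClass S.Chron x.pt y.pt
  comp f g := RelClass.comp S.chron_trans f g
  assoc f g h := RelClass.comp_assoc S.chron_trans f g h

/-- The category of causal homotopy classes; identities are the classes of constant paths. -/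
noncomputable instance (S : Spacetime E X) : Category S.PiC where
  Hom x y := RelClass S.Caus x.pt y.pt
  id x := (RelPath.const S.caus_refl x.pt).cls
  comp f g := RelClass.comp S.caus_trans f g
  id_comp f := RelClass.const_comp S.caus_trans S.caus_refl f
  comp_id f := RelClass.comp_const S.caus_trans S.caus_refl f
  assoc f g h := RelClass.comp_assoc S.caus_trans f g h

/-- The morphism of the causal category represented by a causal path. -/
def causalHom (S : Spacetime E X) {x y : X} (c : S.CausalPath x y) :
    (PiC.mk x : S.PiC) ⟶ PiC.mk y := c.cls

end

end Spacetime

namespace LorentzianMetric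

variable {E : Type*} [NormedAddCommGroup E] [NormedSpace ℝ E]
  {X : Type*} [TopologicalSpace X] [ChartedSpace E X] [IsManifold 𝓘(ℝ, E) ∞ X]

/-- The metric is positive definite on the orthogonal complement of a timelike vector. -/
theorem pos_of_orthogonal (g : LorentzianMetric E X) {x : X} {u w : TangentSpace 𝓘(ℝ, E) x}
    (hu : g.val x u u < 0) (huw : g.val x u w = 0) (hw : w ≠ 0) : 0 < g.val x w w := by
  obtain ⟨v, hv, hpos⟩ := g.signature x
  by_contra! hww
  have hwu : g.val x w u = 0 := by rw [g.symm, huw]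
  have hz : g.val x v w • u - g.val x v u • w = 0 := by
    by_contra hne
    have h1 := hpos (g.val x v w • u - g.val x v u • w)
      (by simp only [map_sub, map_smul, smul_eq_mul]; ring) hne
    simp only [map_sub, map_smul, smul_eq_mul, sub_apply,
      smul_apply, huw, hwu] at h1
    nlinarith [mul_nonneg (sq_nonneg (g.val x v w)) (neg_nonneg.2 hu.le),
      mul_nonneg (sq_nonneg (g.val x v u)) (neg_nonneg.2 hww)]
  have h2 := congrArg (g.val x u) hz
  simp only [map_sub, map_smul, smul_eq_mul, huw, map_zero, mul_zero, sub_zero] at h2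
  exact hww.not_gt (hpos w ((mul_eq_zero.1 h2).resolve_right hu.ne) hw)

theorem continuous_apply (g : LorentzianMetric E X) {M : Type*} [TopologicalSpace M] {b : M → X}
    {v w : ∀ m, TangentSpace 𝓘(ℝ, E) (b m)}
    (hv : Continuous fun m ↦ (⟨b m, v m⟩ : TangentBundle 𝓘(ℝ, E) X))
    (hw : Continuous fun m ↦ (⟨b m, w m⟩ : TangentBundle 𝓘(ℝ, E) X)) :
    Continuous fun m ↦ g.val (b m) (v m) (w m) := by
  have hb : Continuous b := (FiberBundle.continuous_proj E (TangentSpace 𝓘(ℝ, E))).comp hv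
  have h := Continuous.clm_bundle_apply₂ (F₁ := E) (F₂ := E) (F₃ := ℝ) (E₃ := Bundle.Trivial X ℝ)
    (g.smooth.continuous.comp hb) hv hw
  simp only [continuous_iff_continuousAt, FiberBundle.continuousAt_totalSpace] at h ⊢
  exact fun m ↦ (h m).2

end LorentzianMetric

namespace Spacetime

variable {E : Type*} [NormedAddCommGroup E] [NormedSpace ℝ E]
  {X : Type*} [TopologicalSpace X] [ChartedSpace E X] [IsManifold 𝓘(ℝ, E) ∞ X]

theorem continuous_metric_self (S : Spacetime E X) :
    Continuous fun v : TangentBundle 𝓘(ℝ, E) X ↦ S.metric.val v.1 v.2 v.2 :=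
  S.metric.continuous_apply continuous_id continuous_id

theorem continuous_metric_timeField (S : Spacetime E X) :
    Continuous fun v : TangentBundle 𝓘(ℝ, E) X ↦ S.metric.val v.1 (S.timeField v.1) v.2 :=
  S.metric.continuous_apply
    (S.continuous_timeField.comp (FiberBundle.continuous_proj E (TangentSpace 𝓘(ℝ, E))))
    continuous_id

theorem isOpen_isFutureTimelike (S : Spacetime E X) :
    IsOpen {v : TangentBundle 𝓘(ℝ, E) X | S.IsFutureTimelike v.2} :=
  (isOpen_lt S.continuous_metric_self continuous_const).inter
    (isOpen_lt S.continuous_metric_timeField continuous_const)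

theorem isFutureTimelike_timeField (S : Spacetime E X) (x : X) :
    S.IsFutureTimelike (S.timeField x) :=
  ⟨S.timelike_timeField x, S.timelike_timeField x⟩

theorem IsFutureTimelike.isFutureCausal {S : Spacetime E X} {x : X} {v : TangentSpace 𝓘(ℝ, E) x}
    (h : S.IsFutureTimelike v) : S.IsFutureCausal v := ⟨h.1.le, h.2⟩

theorem IsFutureCausal.ne_zero {S : Spacetime E X} {x : X} {v : TangentSpace 𝓘(ℝ, E) x}
    (h : S.IsFutureCausal v) : v ≠ 0 := by
  rintro rfl
  simpa using h.2

theorem IsFutureCausal.smul {S : Spacetime E X} {x : X} {v : TangentSpace 𝓘(ℝ, E) x}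
    (h : S.IsFutureCausal v) {r : ℝ} (hr : 0 < r) : S.IsFutureCausal (r • v) := by
  constructor
  · simp only [map_smul, smul_apply, smul_eq_mul]
    exact mul_nonpos_of_nonneg_of_nonpos hr.le (mul_nonpos_of_nonneg_of_nonpos hr.le h.1)
  · simp only [map_smul, smul_eq_mul]
    exact mul_neg_of_pos_of_neg hr h.2

theorem IsFutureTimelike.smul {S : Spacetime E X} {x : X} {v : TangentSpace 𝓘(ℝ, E) x}
    (h : S.IsFutureTimelike v) {r : ℝ} (hr : 0 < r) : S.IsFutureTimelike (r • v) := by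
  constructor
  · simp only [map_smul, smul_apply, smul_eq_mul]
    exact mul_neg_of_pos_of_neg hr (mul_neg_of_pos_of_neg hr h.1)
  · simp only [map_smul, smul_eq_mul]
    exact mul_neg_of_pos_of_neg hr h.2

/-- On the neighbourhood `U` of `x`, the future causal vectors, read in the chart at `x`, lie in the
convex cone `{a | c * ‖a‖ < ℓ a}`. -/
structure IsCone (S : Spacetime E X) (x : X) (U : Set X) (ℓ : E →L[ℝ] ℝ) (c : ℝ) : Prop where
  isOpen : IsOpen U
  mem : x ∈ U
  subset_source : U ⊆ (chartAt E x).source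
  pos : 0 < c
  lt : ∀ p ∈ U, ∀ v : TangentSpace 𝓘(ℝ, E) p, S.IsFutureCausal v →
    c * ‖(trivializationAt E (TangentSpace 𝓘(ℝ, E)) x).continuousLinearMapAt ℝ p v‖ <
      ℓ ((trivializationAt E (TangentSpace 𝓘(ℝ, E)) x).continuousLinearMapAt ℝ p v)

theorem exists_isCone (S : Spacetime E X) [FiniteDimensional ℝ E] (x : X) :
    ∃ U ℓ c, S.IsCone x U ℓ c := by
  set e := trivializationAt E (TangentSpace 𝓘(ℝ, E)) x with he
  have hxe : x ∈ e.baseSet := mem_chart_source E x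
  set ℓ : E →L[ℝ] ℝ := -(S.metric.val x (S.timeField x)).comp (e.symmL ℝ x) with hℓ
  have key : ∀ᶠ z : X × ℝ in 𝓝 (x, 0), ∀ a ∈ Metric.sphere (0 : E) 1,
      S.IsFutureCausal (e.symm z.1 a) → z.2 < ℓ a := by
    refine (isCompact_sphere (0 : E) 1).eventually_forall_of_forall_eventually fun a ha ↦ ?_
    have ha0 : a ≠ 0 := by
      rintro rfl
      simp at ha
    have hsymm : ContinuousAt (fun z : (X × ℝ) × E ↦
        (⟨z.1.1, e.symm z.1.1 z.2⟩ : TangentBundle 𝓘(ℝ, E) X)) ((x, 0), a) :=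
      (e.continuousOn_symm.continuousAt ((e.open_baseSet.prod isOpen_univ).mem_nhds
        ⟨hxe, mem_univ _⟩) : ContinuousAt _ (x, a)).comp (x := ((x, (0 : ℝ)), a))
        (f := fun z : (X × ℝ) × E ↦ (z.1.1, z.2)) (by fun_prop)
    by_cases h : 0 < ℓ a
    · have : ∀ᶠ z : (X × ℝ) × E in 𝓝 ((x, 0), a), z.1.2 < ℓ z.2 :=
        (isOpen_lt (by fun_prop) (by fun_prop)).mem_nhds h
      exact this.mono fun z hz _ ↦ hz
    · by_cases h' : 0 < S.metric.val x (S.timeField x) (e.symm x a)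
      · have := (S.continuous_metric_timeField.continuousAt.comp hsymm).eventually
          (lt_mem_nhds h')
        exact this.mono fun z hz hc ↦ absurd hc.2 (not_lt.2 hz.le)
      · have hne : e.symm x a ≠ 0 := by
          intro h0
          apply ha0
          have := e.apply_mk_symm hxe a
          rw [h0] at this
          have h1 : (e ⟨x, 0⟩).2 = a := by rw [this]
          have h2 := (e.continuousLinearMapAt ℝ x).map_zero
          rw [e.continuousLinearMapAt_apply_of_mem ℝ hxe] at h2
          exact h1.symm.trans h2
        have h0 : S.metric.val x (S.timeField x) (e.symm x a) = 0 := by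
          refine le_antisymm (not_lt.1 h') ?_
          have : ℓ a = -S.metric.val x (S.timeField x) (e.symm x a) := by
            simp [hℓ, e.symmL_apply hxe]
          linarith
        have hp := S.metric.pos_of_orthogonal (S.timelike_timeField x) h0 hne
        have := (S.continuous_metric_self.continuousAt.comp hsymm).eventually (lt_mem_nhds hp)
        exact this.mono fun z hz hc ↦ absurd hc.1 (not_le.2 hz)
  rw [nhds_prod_eq] at key
  obtain ⟨pa, hpa, pb, hpb, hP⟩ := Filter.eventually_prod_iff.1 key
  obtain ⟨V, hV, hVo, hxV⟩ := eventually_nhds_iff.1 hpa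
  obtain ⟨c, hc, hcb⟩ := ((hpb.filter_mono nhdsWithin_le_nhds).and
    (self_mem_nhdsWithin : Ioi (0 : ℝ) ∈ 𝓝[>] 0)).exists.imp fun c h ↦ And.intro h.2 h.1
  refine ⟨V ∩ e.baseSet, ℓ, c, hVo.inter e.open_baseSet, ⟨hxV, hxe⟩, fun p hp ↦ hp.2, hc,
    fun p hp v hv ↦ ?_⟩
  set a := e.continuousLinearMapAt ℝ p v with ha
  have hsa : e.symm p a = v := by
    have := e.symmL_continuousLinearMapAt (R := ℝ) hp.2 v
    rwa [e.symmL_apply hp.2] at this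
  have ha0 : a ≠ 0 := by
    intro h0
    apply hv.ne_zero
    rw [← hsa, h0, ← e.symmL_apply (R := ℝ) hp.2, map_zero]
  have hn : 0 < ‖a‖ := norm_pos_iff.2 ha0
  have h := hP (hV p hp.1) hcb (‖a‖⁻¹ • a) (by simp [norm_smul, hn.ne']) (by
    rw [← e.symmL_apply (R := ℝ) hp.2, map_smul, e.symmL_apply hp.2, hsa]
    exact hv.smul (inv_pos.2 hn))
  rw [map_smul, smul_eq_mul, inv_mul_eq_div, lt_div_iff₀ hn] at h
  exact h

end Spacetime

namespace Spacetime

variable {E : Type*} [NormedAddCommGroup E] [NormedSpace ℝ E]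
  {X : Type*} [TopologicalSpace X] [ChartedSpace E X] [IsManifold 𝓘(ℝ, E) ∞ X]

theorem hasDerivWithinAt_extChartAt_comp {x : X} {γ : ℝ → X} {s : Set ℝ} {t : ℝ}
    (hγ : MDifferentiableWithinAt 𝓘(ℝ, ℝ) 𝓘(ℝ, E) γ s t) (ht : γ t ∈ (chartAt E x).source) :
    HasDerivWithinAt (extChartAt 𝓘(ℝ, E) x ∘ γ)
      ((trivializationAt E (TangentSpace 𝓘(ℝ, E)) x).continuousLinearMapAt ℝ (γ t)
        (mfderivWithin 𝓘(ℝ, ℝ) 𝓘(ℝ, E) γ s t (1 : ℝ))) s t := by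
  rw [TangentBundle.continuousLinearMapAt_trivializationAt ht]
  have h : HasFDerivWithinAt (𝕜 := ℝ) (E := ℝ) (F := E) (extChartAt 𝓘(ℝ, E) x ∘ γ)
      ((mfderiv 𝓘(ℝ, E) 𝓘(ℝ, E) (extChartAt 𝓘(ℝ, E) x) (γ t)).comp
        (mfderivWithin 𝓘(ℝ, ℝ) 𝓘(ℝ, E) γ s t) : ℝ →L[ℝ] E) s t :=
    ((mdifferentiableAt_extChartAt ht).hasMFDerivAt.comp_hasMFDerivWithinAt t
      hγ.hasMFDerivWithinAt).hasFDerivWithinAt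
  have h' := HasFDerivWithinAt.hasDerivWithinAt (𝕜 := ℝ) (F := E) h
  exact h'

theorem TimelikeCurve.causalCurve {S : Spacetime E X} {U : Set X} {p q : X}
    (h : S.TimelikeCurve U p q) : S.CausalCurve U p q := by
  obtain ⟨γ, h1, h2, h3, h4, h5⟩ := h
  exact ⟨γ, h1, h2, h3, h4, fun t ht ↦ (h5 t ht).isFutureCausal⟩

theorem Chron.caus {S : Spacetime E X} {U : Set X} {p q : X} (h : S.Chron U p q) :
    S.Caus U p q :=
  (Relation.TransGen.mono (fun _ _ h ↦ TimelikeCurve.causalCurve h) _ _ h).to_reflTransGen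

/-- The causal path underlying a timelike path. -/
def TimelikePath.causal {S : Spacetime E X} {x y : X} (c : S.TimelikePath x y) :
    S.CausalPath x y :=
  ⟨c.1, fun t U hU ↦ (c.2 t U hU).imp fun _ h ↦ ⟨h.1, fun a ha b hb hab ↦
    (h.2 a ha b hb hab).caus⟩⟩

namespace IsCone

variable {S : Spacetime E X} {x : X} {U : Set X} {ℓ : E →L[ℝ] ℝ} {c : ℝ}

theorem causalCurve (h : S.IsCone x U ℓ c) {p q : X} (hpq : S.CausalCurve U p q) :
    c * ‖extChartAt 𝓘(ℝ, E) x q - extChartAt 𝓘(ℝ, E) x p‖ ≤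
        ℓ (extChartAt 𝓘(ℝ, E) x q) - ℓ (extChartAt 𝓘(ℝ, E) x p) ∧
      ℓ (extChartAt 𝓘(ℝ, E) x p) < ℓ (extChartAt 𝓘(ℝ, E) x q) := by
  obtain ⟨γ, hγ, hU, rfl, rfl, hd⟩ := hpq
  set f : ℝ → E := extChartAt 𝓘(ℝ, E) x ∘ γ with hf
  set f' : ℝ → E := fun t ↦ (trivializationAt E (TangentSpace 𝓘(ℝ, E)) x).continuousLinearMapAt ℝ
    (γ t) (mfderivWithin 𝓘(ℝ, ℝ) 𝓘(ℝ, E) γ (Icc 0 1) t (1 : ℝ)) with hf'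
  have hder : ∀ t ∈ Icc (0 : ℝ) 1, HasDerivWithinAt f (f' t) (Icc 0 1) t := fun t ht ↦
    hasDerivWithinAt_extChartAt_comp ((hγ t ht).mdifferentiableWithinAt (by simp))
      (h.subset_source (hU ht))
  have hlt : ∀ t ∈ Icc (0 : ℝ) 1, c * ‖f' t‖ < ℓ (f' t) := fun t ht ↦ h.lt _ (hU ht) _ (hd t ht)
  have hℓ : ∀ t ∈ Icc (0 : ℝ) 1, HasDerivWithinAt (fun t ↦ ℓ (f t)) (ℓ (f' t)) (Icc 0 1) t :=
    fun t ht ↦ ℓ.hasFDerivAt.comp_hasDerivWithinAt t (hder t ht)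
  have hIci : ∀ t ∈ Ico (0 : ℝ) 1, Icc (0 : ℝ) 1 ∈ 𝓝[≥] t := fun t ht ↦
    Filter.mem_of_superset (Icc_mem_nhdsGE ht.2) (Icc_subset_Icc_left ht.1)
  constructor
  · have := image_norm_le_of_norm_deriv_right_le_deriv_boundary' (f := fun t ↦ c • (f t - f 0))
      (f' := fun t ↦ c • f' t) (a := 0) (b := 1) (B := fun t ↦ ℓ (f t) - ℓ (f 0))
      (B' := fun t ↦ ℓ (f' t))
      (fun t ht ↦ (((hder t ht).sub_const _).const_smul c).continuousWithinAt)
      (fun t ht ↦ (((hder t (Ico_subset_Icc_self ht)).sub_const _).const_smul c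
        ).mono_of_mem_nhdsWithin (hIci t ht))
      (by simp) (fun t ht ↦ ((hℓ t ht).sub_const _).continuousWithinAt)
      (fun t ht ↦ ((hℓ t (Ico_subset_Icc_self ht)).sub_const _).mono_of_mem_nhdsWithin (hIci t ht))
      (fun t ht ↦ by
        rw [norm_smul, Real.norm_of_nonneg h.pos.le]
        exact (hlt t (Ico_subset_Icc_self ht)).le) (right_mem_Icc.2 zero_le_one)
    simp only [norm_smul, Real.norm_of_nonneg h.pos.le] at this
    exact this
  · refine strictMonoOn_of_deriv_pos (f := fun t ↦ ℓ (f t)) (convex_Icc (0 : ℝ) 1)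
      (fun t ht ↦ (hℓ t ht).continuousWithinAt) (fun t ht ↦ ?_) (left_mem_Icc.2 zero_le_one)
      (right_mem_Icc.2 zero_le_one) zero_lt_one
    rw [interior_Icc] at ht
    have ht' := Ioo_subset_Icc_self ht
    rw [((hℓ t ht').hasDerivAt (Icc_mem_nhds ht.1 ht.2)).deriv]
    exact (mul_nonneg h.pos.le (norm_nonneg _)).trans_lt (hlt t ht')

theorem caus (h : S.IsCone x U ℓ c) {p q : X} (hpq : S.Caus U p q) :
    c * ‖extChartAt 𝓘(ℝ, E) x q - extChartAt 𝓘(ℝ, E) x p‖ ≤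
      ℓ (extChartAt 𝓘(ℝ, E) x q) - ℓ (extChartAt 𝓘(ℝ, E) x p) := by
  induction hpq with
  | refl => simp
  | @tail y z _ hyz ih =>
    have h1 := (h.causalCurve hyz).1
    have h2 := mul_le_mul_of_nonneg_left (norm_sub_le_norm_sub_add_norm_sub
      (extChartAt 𝓘(ℝ, E) x z) (extChartAt 𝓘(ℝ, E) x y) (extChartAt 𝓘(ℝ, E) x p)) h.pos.le
    linarith

theorem caus_le (h : S.IsCone x U ℓ c) {p q : X} (hpq : S.Caus U p q) :
    ℓ (extChartAt 𝓘(ℝ, E) x p) ≤ ℓ (extChartAt 𝓘(ℝ, E) x q) :=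
  sub_nonneg.1 ((mul_nonneg h.pos.le (norm_nonneg _)).trans (h.caus hpq))

theorem chron_lt (h : S.IsCone x U ℓ c) {p q : X} (hpq : S.Chron U p q) :
    ℓ (extChartAt 𝓘(ℝ, E) x p) < ℓ (extChartAt 𝓘(ℝ, E) x q) := by
  obtain ⟨y, hpy, hyq⟩ := Relation.TransGen.head'_iff.1 hpq
  refine (h.causalCurve hpy.causalCurve).2.trans_le (h.caus_le ?_)
  exact Relation.ReflTransGen.mono (fun _ _ h ↦ TimelikeCurve.causalCurve h) _ _ hyq

theorem eq_of_eq (h : S.IsCone x U ℓ c) {p q : X} (hp : p ∈ U) (hq : q ∈ U)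
    (hpq : extChartAt 𝓘(ℝ, E) x p = extChartAt 𝓘(ℝ, E) x q) : p = q :=
  (extChartAt 𝓘(ℝ, E) x).injOn (by simpa using h.subset_source hp)
    (by simpa using h.subset_source hq) hpq

end IsCone

end Spacetime

section LocallyRelated

variable {X : Type*} [TopologicalSpace X] {R : Set X → X → X → Prop}

theorem LocallyRelated.rel_of_le {c : I → X} (hc : LocallyRelated R c) {U : Set X} (hU : IsOpen U)
    (hcU : ∀ t, c t ∈ U) (h₁ : ∀ x, R U x x) (hR : ∀ x y z, R U x y → R U y z → R U x z)
    {s t : I} (hst : s ≤ t) : R U (c s) (c t) := by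
  choose J hJ hJR using fun t₀ ↦ hc t₀ U (hU.mem_nhds (hcU t₀))
  obtain ⟨u, hu0, hum, ⟨n, hn⟩, hcov⟩ := exists_monotone_Icc_subset_open_cover_unitInterval
    (c := fun t₀ ↦ interior (J t₀)) (fun _ ↦ isOpen_interior)
    (fun t₀ _ ↦ mem_iUnion.2 ⟨t₀, mem_interior_iff_mem_nhds.2 (hJ t₀)⟩)
  set w : ℕ → I := fun k ↦ max s (min (u k) t) with hw
  have hstep : ∀ k, R U (c (w k)) (c (w (k + 1))) := by
    intro k
    have hle : w k ≤ w (k + 1) := max_le_max le_rfl (min_le_min (hum k.le_succ) le_rfl)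
    rcases hle.eq_or_lt with he | hlt
    · rw [← he]
      exact h₁ _
    · obtain ⟨t₀, ht₀⟩ := hcov k
      have huk := hum k.le_succ
      have hts : s < min (u (k + 1)) t := by
        by_contra! hcon
        exact absurd hlt (not_lt.2 ((max_eq_left hcon).le.trans (le_max_left _ _)))
      have hut : u k < t := by
        by_contra! hcon
        refine absurd hlt (not_lt.2 ?_)
        simp only [hw]
        rw [min_eq_right hcon, min_eq_right (hcon.trans huk)]
      rw [lt_min_iff] at hts
      refine hJR t₀ _ (interior_subset (ht₀ ⟨?_, ?_⟩)) _ (interior_subset (ht₀ ⟨?_, ?_⟩)) hlt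
      · exact (le_min le_rfl hut.le).trans (le_max_right _ _)
      · exact max_le hts.1.le ((min_le_left _ _).trans huk)
      · exact (le_min huk hut.le).trans (le_max_right _ _)
      · exact max_le hts.1.le (min_le_left _ _)
  have hall : ∀ k, R U (c (w 0)) (c (w k)) := by
    intro k
    induction k with
    | zero => exact h₁ _
    | succ k ih => exact hR _ _ _ ih (hstep k)
  have h := hall n
  have e0 : w 0 = s := by simp [hw, hu0]
  have e1 : w n = t := by
    simp only [hw, hn n le_rfl]
    rw [min_eq_right le_one', max_eq_right hst]
  rwa [e0, e1] at h

/-- If the related paths in the open set `U` between two points stay in the closed set `K ⊆ U`, then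
a homotopy cannot leave `U`. -/
theorem RelHomotopic.forall_mem {x y : X} {U K : Set X} (hU : IsOpen U) (hK : IsClosed K)
    (hKU : K ⊆ U) (hRK : ∀ a : RelPath R x y, (∀ t, a.1 t ∈ U) → ∀ t, a.1 t ∈ K)
    {a b : RelPath R x y} (hab : RelHomotopic R a b) (ha : ∀ t, a.1 t ∈ U) :
    ∀ t, b.1 t ∈ K := by
  obtain ⟨H, hH⟩ := hab
  have hUK : {s : I | ∀ t, H (s, t) ∈ U} = {s : I | ∀ t, H (s, t) ∈ K} := by
    ext s
    exact ⟨fun h ↦ hRK ⟨H.eval s, hH s⟩ h, fun h t ↦ hKU (h t)⟩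
  have ho : IsOpen {s : I | ∀ t, H (s, t) ∈ U} := by
    refine isOpen_iff_mem_nhds.2 fun s hs ↦ ?_
    have := isCompact_univ.eventually_forall_of_forall_eventually (x₀ := s)
      (P := fun s t ↦ H (s, t) ∈ U) fun t _ ↦ H.continuous.continuousAt (hU.mem_nhds (hs t))
    exact this.mono fun s h t ↦ h t (mem_univ t)
  have hc : IsClosed {s : I | ∀ t, H (s, t) ∈ U} := by
    rw [hUK, ofPred_forall]
    exact isClosed_iInter fun t ↦ hK.preimage (by fun_prop)
  have huniv := IsClopen.eq_univ ⟨hc, ho⟩ ⟨0, fun t ↦ by simpa using ha t⟩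
  have h1 : (1 : I) ∈ {s : I | ∀ t, H (s, t) ∈ K} := by
    rw [← hUK, huniv]
    exact mem_univ _
  intro t
  simpa using h1 t

end LocallyRelated

namespace Spacetime

variable {E : Type*} [NormedAddCommGroup E] [NormedSpace ℝ E]
  {X : Type*} [TopologicalSpace X] [ChartedSpace E X] [IsManifold 𝓘(ℝ, E) ∞ X]

/-- A chart-straight segment with timelike velocities is a timelike curve. -/
theorem timelikeCurve_segment (S : Spacetime E X) {x : X} {b : E} {V : Set X} {s t : ℝ}
    (hst : s < t)
    (htar : ∀ r ∈ Icc s t, extChartAt 𝓘(ℝ, E) x x + r • b ∈ (extChartAt 𝓘(ℝ, E) x).target)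
    (hV : ∀ r ∈ Icc s t, (extChartAt 𝓘(ℝ, E) x).symm (extChartAt 𝓘(ℝ, E) x x + r • b) ∈ V)
    (hb : ∀ r ∈ Icc s t, S.IsFutureTimelike
      ((trivializationAt E (TangentSpace 𝓘(ℝ, E)) x).symmL ℝ
        ((extChartAt 𝓘(ℝ, E) x).symm (extChartAt 𝓘(ℝ, E) x x + r • b)) b)) :
    S.TimelikeCurve V ((extChartAt 𝓘(ℝ, E) x).symm (extChartAt 𝓘(ℝ, E) x x + s • b))
      ((extChartAt 𝓘(ℝ, E) x).symm (extChartAt 𝓘(ℝ, E) x x + t • b)) := by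
  set ψ := extChartAt 𝓘(ℝ, E) x with hψ
  set e := trivializationAt E (TangentSpace 𝓘(ℝ, E)) x with he
  set l : ℝ → E := fun r ↦ ψ x + (s + r * (t - s)) • b with hl
  have hmem : ∀ r ∈ Icc (0 : ℝ) 1, s + r * (t - s) ∈ Icc s t := fun r hr ↦
    ⟨by nlinarith [hr.1], by nlinarith [hr.2]⟩
  have hsm : ContMDiffOn 𝓘(ℝ, ℝ) 𝓘(ℝ, E) ∞ (ψ.symm ∘ l) (Icc 0 1) := by
    refine (contMDiffOn_extChartAt_symm x).comp (t := ψ.target) ?_ fun r hr ↦ htar _ (hmem r hr)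
    have : ContDiff ℝ ∞ l := by fun_prop
    exact this.contMDiff.contMDiffOn
  refine ⟨ψ.symm ∘ l, hsm, fun r hr ↦ hV _ (hmem r hr), by simp [hl], by simp [hl], fun r hr ↦ ?_⟩
  have hsrc : (ψ.symm ∘ l) r ∈ (chartAt E x).source := by
    have := ψ.map_target (htar _ (hmem r hr))
    rwa [hψ, extChartAt_source] at this
  have hd := hasDerivWithinAt_extChartAt_comp (x := x)
    ((hsm r hr).mdifferentiableWithinAt (by simp)) hsrc
  have hd' : HasDerivWithinAt (extChartAt 𝓘(ℝ, E) x ∘ (ψ.symm ∘ l)) ((t - s) • b) (Icc 0 1) r := by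
    have h1 : HasDerivAt l ((t - s) • b) r := by
      have := ((((hasDerivAt_id r).mul_const (t - s)).const_add s).smul_const b).const_add (ψ x)
      rw [one_mul] at this
      exact this
    exact h1.hasDerivWithinAt.congr_of_mem (fun u hu ↦ ψ.right_inv (htar _ (hmem u hu))) hr
  have hu := (uniqueDiffOn_Icc zero_lt_one r hr).eq_deriv _ hd hd'
  have hv := e.symmL_continuousLinearMapAt (R := ℝ) (b := (ψ.symm ∘ l) r) hsrc
    (mfderivWithin 𝓘(ℝ, ℝ) 𝓘(ℝ, E) (ψ.symm ∘ l) (Icc 0 1) r (1 : ℝ))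
  rw [hu, map_smul] at hv
  rw [← hv]
  exact (hb _ (hmem r hr)).smul (sub_pos.2 hst)

theorem exists_timelikePath (S : Spacetime E X) {x : X} {W : Set X} (hW : W ∈ 𝓝 x) :
    ∃ (y : X) (c : S.TimelikePath x y), ∀ t, c.1 t ∈ W := by
  set ψ := extChartAt 𝓘(ℝ, E) x with hψ
  set e := trivializationAt E (TangentSpace 𝓘(ℝ, E)) x with he
  have hxe : x ∈ e.baseSet := mem_chart_source E x
  set a : E := e.continuousLinearMapAt ℝ x (S.timeField x) with ha
  have hN : ∀ᶠ p in 𝓝 x, p ∈ W ∧ S.IsFutureTimelike (e.symmL ℝ p a) := by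
    refine Filter.Eventually.and hW ?_
    have hc : ContinuousAt (fun p ↦ (⟨p, e.symm p a⟩ : TangentBundle 𝓘(ℝ, E) X)) x :=
      (e.continuousOn_symm.continuousAt ((e.open_baseSet.prod isOpen_univ).mem_nhds
        ⟨hxe, mem_univ _⟩) : ContinuousAt _ (x, a)).comp (x := x)
        (f := fun p ↦ (p, a)) (by fun_prop)
    have hx : S.IsFutureTimelike (e.symm x a) := by
      rw [← e.symmL_apply (R := ℝ) hxe, e.symmL_continuousLinearMapAt hxe]
      exact S.isFutureTimelike_timeField x
    filter_upwards [hc (S.isOpen_isFutureTimelike.mem_nhds hx), e.open_baseSet.mem_nhds hxe]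
      with p hp hpe
    rw [e.symmL_apply hpe]
    exact hp
  have hl : Filter.Tendsto (fun r : ℝ ↦ ψ x + r • a) (𝓝 0) (𝓝 (ψ x)) := by
    have : Continuous fun r : ℝ ↦ ψ x + r • a := by fun_prop
    simpa using this.tendsto 0
  have h1 : ∀ᶠ r in 𝓝 (0 : ℝ), ψ x + r • a ∈ ψ.target :=
    hl (extChartAt_target_mem_nhds x)
  have h2 : ∀ᶠ r in 𝓝 (0 : ℝ), ψ.symm (ψ x + r • a) ∈ W ∧
      S.IsFutureTimelike (e.symmL ℝ (ψ.symm (ψ x + r • a)) a) := by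
    refine hl.eventually (p := fun z ↦ ψ.symm z ∈ W ∧ S.IsFutureTimelike (e.symmL ℝ (ψ.symm z) a)) ?_
    have : ContinuousAt ψ.symm (ψ x) := continuousAt_extChartAt_symm x
    rw [ContinuousAt, extChartAt_to_inv] at this
    exact this.eventually hN
  obtain ⟨ε, hε, hball⟩ := Metric.eventually_nhds_iff.1 (h1.and h2)
  set b : E := (ε / 2) • a with hb
  have hgood : ∀ r ∈ Icc (0 : ℝ) 1, ψ x + r • b ∈ ψ.target ∧ ψ.symm (ψ x + r • b) ∈ W ∧
      S.IsFutureTimelike (e.symmL ℝ (ψ.symm (ψ x + r • b)) b) := by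
    intro r hr
    have h := @hball (r * (ε / 2)) (by
      rw [Real.dist_0_eq_abs, abs_of_nonneg (mul_nonneg hr.1 (by positivity))]
      nlinarith [hr.2])
    rw [mul_smul] at h
    refine ⟨h.1, h.2.1, ?_⟩
    rw [hb, map_smul]
    exact h.2.2.smul (by positivity)
  have hcont : Continuous fun t : I ↦ ψ.symm (ψ x + (t : ℝ) • b) :=
    (continuousOn_extChartAt_symm x).comp_continuous (by fun_prop) fun t ↦ (hgood t t.2).1
  refine ⟨_, ⟨⟨⟨fun t : I ↦ ψ.symm (ψ x + (t : ℝ) • b), hcont⟩, ?_, rfl⟩, fun t₀ V hV ↦ ?_⟩,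
    fun t ↦ (hgood t t.2).2.1⟩
  · simp [hψ]
  · obtain ⟨δ, hδ, hJ⟩ := Metric.mem_nhds_iff.1 (hcont.continuousAt hV)
    refine ⟨_, Metric.ball_mem_nhds t₀ hδ, fun t₁ h₁ t₂ h₂ h₁₂ ↦ .single ?_⟩
    have hI : ∀ r ∈ Icc (t₁ : ℝ) t₂, r ∈ Icc (0 : ℝ) 1 := fun r hr ↦
      ⟨t₁.2.1.trans hr.1, hr.2.trans t₂.2.2⟩
    refine S.timelikeCurve_segment h₁₂ (fun r hr ↦ (hgood r (hI r hr)).1) (fun r hr ↦ ?_)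
      fun r hr ↦ (hgood r (hI r hr)).2.2
    refine @hJ ⟨r, hI r hr⟩ ?_
    rw [Metric.mem_ball, Subtype.dist_eq, Real.dist_eq, abs_lt] at h₁ h₂ ⊢
    exact ⟨by linarith [hr.1, h₁.1], by linarith [hr.2, h₂.2]⟩

theorem TimelikePath.not_const [FiniteDimensional ℝ E] {S : Spacetime E X} {x y : X}
    (c : S.TimelikePath x y) : ¬ ∀ t, c.1 t = x := by
  intro h
  obtain ⟨U, ℓ, k, hU⟩ := S.exists_isCone x
  obtain ⟨J, hJ, hJR⟩ := c.2 0 U (by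
    rw [h]
    exact hU.isOpen.mem_nhds hU.mem)
  have : (𝓝[>] (0 : I)).NeBot := nhdsGT_neBot_of_exists_gt ⟨1, zero_lt_one⟩
  obtain ⟨t, htJ, ht⟩ := Filter.nonempty_of_mem (f := 𝓝[>] (0 : I))
    (Filter.inter_mem (nhdsWithin_le_nhds hJ) self_mem_nhdsWithin)
  have := hU.chron_lt (hJR 0 (mem_of_mem_nhds hJ) t htJ ht)
  rw [h, h] at this
  exact lt_irrefl _ this

namespace IsCone

variable {S : Spacetime E X} {x : X} {U : Set X} {ℓ : E →L[ℝ] ℝ} {c : ℝ}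

theorem path_caus {y z : X} (γ : S.CausalPath y z) (h : S.IsCone x U ℓ c) (hγ : ∀ t, γ.1 t ∈ U)
    {s t : I} (hst : s ≤ t) : S.Caus U (γ.1 s) (γ.1 t) :=
  γ.2.rel_of_le h.isOpen hγ (fun _ ↦ .refl) (S.caus_trans U) hst

theorem norm_path_le {y z : X} (γ : S.CausalPath y z) (h : S.IsCone x U ℓ c)
    (hγ : ∀ t, γ.1 t ∈ U) (t : I) :
    c * ‖extChartAt 𝓘(ℝ, E) x (γ.1 t) - extChartAt 𝓘(ℝ, E) x y‖ ≤
      ℓ (extChartAt 𝓘(ℝ, E) x z) - ℓ (extChartAt 𝓘(ℝ, E) x y) := by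
  have h1 := h.caus (h.path_caus γ hγ (s := 0) (t := t) t.2.1)
  have h2 := h.caus_le (h.path_caus γ hγ (s := t) (t := 1) t.2.2)
  rw [γ.1.source] at h1
  rw [γ.1.target] at h2
  linarith

/-- A causal loop in a cone neighbourhood is constant. -/
theorem loop_eq {y : X} (γ : S.CausalPath y y) (h : S.IsCone x U ℓ c) (hγ : ∀ t, γ.1 t ∈ U)
    (t : I) : γ.1 t = y := by
  have h1 := h.norm_path_le γ hγ t
  rw [sub_self] at h1
  have h2 : ‖extChartAt 𝓘(ℝ, E) x (γ.1 t) - extChartAt 𝓘(ℝ, E) x y‖ = 0 :=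
    le_antisymm (nonpos_of_mul_nonpos_right h1 h.pos) (norm_nonneg _)
  have hy : y ∈ U := by simpa using hγ 0
  exact h.eq_of_eq (hγ t) hy (sub_eq_zero.1 (norm_eq_zero.1 h2))

end IsCone

variable [FiniteDimensional ℝ E] [T2Space X]

theorem relHomotopic_const_iff (S : Spacetime E X) {x : X} (γ : S.CausalPath x x) :
    RelHomotopic S.Caus (RelPath.const S.caus_refl x) γ ↔ ∀ t, γ.1 t = x := by
  constructor
  · intro h
    obtain ⟨U, ℓ, c, hU⟩ := S.exists_isCone x
    exact h.forall_mem hU.isOpen (isClosed_singleton (x := x)) (singleton_subset_iff.2 hU.mem)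
      (fun a ha t ↦ hU.loop_eq a ha t) fun _ ↦ hU.mem
  · intro h
    have : γ = RelPath.const S.caus_refl x := Subtype.ext (Path.ext (funext h))
    rw [this]
    exact RelHomotopic.refl _

theorem causalHom_eq_id_iff (S : Spacetime E X) {x : X} (γ : S.CausalPath x x) :
    S.causalHom γ = 𝟙 _ ↔ ∀ t, γ.1 t = x := by
  rw [← S.relHomotopic_const_iff γ]
  exact ⟨fun h ↦ (Quotient.exact h).symm, fun h ↦ Quotient.sound h.symm⟩

theorem causalHom_const_of_isIso (S : Spacetime E X) {x y : X} (γ : S.CausalPath x y)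
    (h : IsIso (S.causalHom γ)) (t : I) : γ.1 t = x := by
  obtain ⟨g, hg, -⟩ := h
  obtain ⟨δ, rfl⟩ : ∃ δ : S.CausalPath y x, S.causalHom δ = g := Quotient.exists_rep g
  have h1 : S.causalHom (RelPath.trans S.caus_trans γ δ) = 𝟙 _ := hg
  rw [causalHom_eq_id_iff] at h1
  have h2 : γ.1 t ∈ range (γ.1.trans δ.1) := by
    rw [Path.trans_range]
    exact .inl ⟨t, rfl⟩
  obtain ⟨s, hs⟩ := h2
  rw [← hs]
  exact h1 s

theorem eq_eqToHom_of_isIso (S : Spacetime E X) {x y : S.PiC} (f : x ⟶ y) (hf : IsIso f) :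
    ∃ h : x = y, f = eqToHom h := by
  obtain ⟨x⟩ := x
  obtain ⟨y⟩ := y
  obtain ⟨γ, rfl⟩ : ∃ γ : S.CausalPath x y, S.causalHom γ = f := Quotient.exists_rep f
  have h := S.causalHom_const_of_isIso γ hf
  obtain rfl : x = y := by simpa using (h 1).symm
  exact ⟨rfl, (S.causalHom_eq_id_iff γ).2 h⟩

theorem not_isGroupoid (S : Spacetime E X) [Nonempty X] : ¬ IsGroupoid S.PiC := by
  intro h
  obtain ⟨y, γ, -⟩ := S.exists_timelikePath (x := Classical.arbitrary X) Filter.univ_mem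
  exact γ.not_const (S.causalHom_const_of_isIso γ.causal (h.all_isIso _))

/-- Short timelike paths starting at `x` are not homotopic to paths that leave a neighbourhood of
`x`. -/
theorem exists_timelikePath_forall_relHomotopic (S : Spacetime E X) (x : X) :
    ∃ U ℓ c, S.IsCone x U ℓ c ∧ ∃ (y : X) (a : S.TimelikePath x y),
      ∀ b, RelHomotopic S.Chron a b → ∀ t, b.1 t ∈ U := by
  obtain ⟨U, ℓ, c, hU⟩ := S.exists_isCone x
  have hUx : U ∈ 𝓝 x := hU.isOpen.mem_nhds hU.mem
  set ψ := extChartAt 𝓘(ℝ, E) x with hψ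
  have hnhds : ψ.target ∩ ψ.symm ⁻¹' U ∈ 𝓝 (ψ x) := by
    refine Filter.inter_mem (extChartAt_target_mem_nhds x)
      ((continuousAt_extChartAt_symm x : ContinuousAt ψ.symm (ψ x)).preimage_mem_nhds ?_)
    rwa [extChartAt_to_inv]
  obtain ⟨r, hr, hball⟩ := Metric.nhds_basis_closedBall.mem_iff.1 hnhds
  set K := ψ.symm '' Metric.closedBall (ψ x) r with hK
  have hKU : K ⊆ U := image_subset_iff.2 fun z hz ↦ (hball hz).2
  have hKc : IsClosed K := ((isCompact_closedBall (ψ x) r).image_of_continuousOn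
    ((continuousOn_extChartAt_symm x).mono fun z hz ↦ (hball hz).1)).isClosed
  have hW : U ∩ {p | ℓ (ψ p) < ℓ (ψ x) + c * r} ∈ 𝓝 x := by
    refine Filter.inter_mem hUx ?_
    have : ContinuousAt (fun p ↦ ℓ (ψ p)) x :=
      ℓ.continuous.continuousAt.comp (continuousAt_extChartAt x)
    exact this.eventually (gt_mem_nhds (lt_add_of_pos_right _ (mul_pos hU.pos hr)))
  obtain ⟨y, a, ha⟩ := S.exists_timelikePath hW
  have hy : ℓ (ψ y) < ℓ (ψ x) + c * r := by simpa using (ha 1).2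
  refine ⟨U, ℓ, c, hU, y, a, fun b hab t ↦ hKU (hab.forall_mem hU.isOpen hKc hKU ?_
    (fun t ↦ (ha t).1) t)⟩
  intro γ hγ t
  have hle := hU.norm_path_le (TimelikePath.causal γ) hγ t
  have hlt : c * ‖ψ (γ.1 t) - ψ x‖ ≤ c * r := hle.trans (by linarith)
  refine ⟨ψ (γ.1 t), ?_, ψ.left_inv ?_⟩
  · rw [mem_closedBall_iff_norm]
    exact le_of_mul_le_mul_left hlt hU.pos
  · rw [hψ, extChartAt_source]
    exact hU.subset_source (hγ t)

theorem not_isIdentity (S : Spacetime E X) {x : S.PiT} (e : x ⟶ x) :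
    ¬ Semicategory.IsIdentity e := by
  intro he
  obtain ⟨x⟩ := x
  obtain ⟨γ, rfl⟩ : ∃ γ : S.TimelikePath x x, γ.cls = e := Quotient.exists_rep e
  obtain ⟨U, ℓ, c, hU, y, a, ha⟩ := S.exists_timelikePath_forall_relHomotopic x
  have h : (RelPath.trans S.chron_trans γ a).cls = a.cls := he.1 (PiT.mk y) a.cls
  have hmem := ha _ (RelHomotopic.symm (Quotient.exact h))
  have hγ : ∀ t, γ.1 t ∈ U := by
    intro t
    have ht : γ.1 t ∈ range (γ.1.trans a.1) := by
      rw [Path.trans_range]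
      exact .inl ⟨t, rfl⟩
    obtain ⟨s, hs⟩ := ht
    rw [← hs]
    exact hmem s
  exact γ.not_const (hU.loop_eq γ.causal hγ)

end Spacetime

theorem mainTheorem5 {E : Type*} [NormedAddCommGroup E] [NormedSpace ℝ E] [FiniteDimensional ℝ E]
    {X : Type*} [TopologicalSpace X] [T2Space X] [Nonempty X] [ChartedSpace E X]
    [IsManifold 𝓘(ℝ, E) ∞ X] (S : Spacetime E X) :
    -- i) a causal path represents an identity morphism iff it is constant
    (∀ (x : X) (c : S.CausalPath x x), S.causalHom c = 𝟙 _ ↔ ∀ t : I, c.1 t = x) ∧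
    -- ii) every invertible morphism is an identity, and the category is not a groupoid
    (∀ (x y : S.PiC) (f : x ⟶ y), IsIso f → ∃ h : x = y, f = eqToHom h) ∧
    ¬ IsGroupoid S.PiC ∧
    -- iii) no morphism of the timelike semicategory is an identity, and it is not a category
    (∀ (x : S.PiT) (e : x ⟶ x), ¬ Semicategory.IsIdentity e) ∧
    ¬ Semicategory.IsCategory S.PiT :=
  ⟨fun _ c ↦ S.causalHom_eq_id_iff c, fun _ _ f hf ↦ S.eq_eqToHom_of_isIso f hf, S.not_isGroupoid,
    fun _ e ↦ S.not_isIdentity e, fun h ↦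
      let ⟨e, he⟩ := h ⟨Classical.arbitrary X⟩
      S.not_isIdentity e he⟩
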